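/- Let $F$ be a (right-continuous, not necessarily continuous) distribution function on $\mathbb R$, let $x_0:=\inf\{x\in\mathbb R: F(x)>0\}$, and assume that $F(x_0)=0$ if $x_0>-\infty$. Let $\mathscr P$ be a Poisson point process on $\mathbb R^2$ whose intensity measure $\lambda$ is given by $$\lambda\bigl((a,b)\times(x,\infty)\bigr)=(a-b)\ln F(x),\quad a<b,\ x>x_0,\qquad \lambda\bigl(\mathbb R\times(-\infty,x_0]\bigr)=0 ,$$ (the second condition being void if $x_0=-\infty$), and let $$\mathscr M_t:=\inf\bigl\{x\in\mathbb R:\mathscr P\bigl((0,t]\times(x,\infty)\bigr)=0\bigr\},\qquad t>0,$$ be the extremal process associated with $F$. Let $b_t$, $t\ge 0$, be a non-decreasing right-continuous real-valued function, $g_t:=1-F(b_t)$, and let $\{\mathscr M_t>b_t\ \text{ev.}\}$ be the event that $\mathscr M_t>b_t$ for all sufficiently large $t$. Then the following holds. (i) One always has $\mathbf P(\mathscr M_t>b_t\ \text{ev.})=0$ or $1$. (ii) If $g_t\to c>0$ as $t\to\infty$, then $\mathbf P(\mathscr M_t>b_t\ \text{ev.})=1$. (iii) If $\lim_{t\to\infty}g_t=0$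 and $\liminf_{t\to\infty}t g_t<\infty$, then $\mathbf P(\mathscr M_t>b_t\ \text{ev.})=0$. (iv) If $\lim_{t\to\infty}g_t=0$ and $\lim_{t\to\infty}t g_t=\infty$, then $$\mathbf P(\mathscr M_t>b_t\ \text{ev.})=\begin{cases}0&\text{if } J(b)=\infty,\\ 1&\text{if } J(b)<\infty,\end{cases}\qquad\text{where } J(b):=\int_0^\infty g_t e^{-t g_t}\,dt .$$ -/

import Mathlib

open Set Filter Topology MeasureTheory ProbabilityTheory
open scoped ENNReal NNReal

namespace ExtremalProcess

/-- The point `Q(s) = inf {x : F x ≥ e^{-s}}`, i.e. the generalized inverse of `F` at `e^{-s}`. -/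
noncomputable def quantileExp (F : ℝ → ℝ) (s : ℝ) : ℝ :=
  sInf {x : ℝ | Real.exp (-s) ≤ F x}

/-- The measure on the line with tail `(x, ∞) ↦ -ln F(x)` whenever `F x > 0`, and with no mass on
`(-∞, x₀]`, `x₀ = inf {x : F x > 0}`; it is the image of Lebesgue measure on
`(0, ∞)` under `s ↦ inf {x : F x ≥ e^{-s}}`. -/
noncomputable def tailMeasure (F : ℝ → ℝ) : Measure ℝ :=
  (volume.restrict (Ioi (0 : ℝ))).map (quantileExp F)

/-- The intensity measure `λ` on the plane (time, level), with
`λ ((a, b) × (x, ∞)) = (a - b) ln F(x)` for `a < b`, `x > x₀`, and `λ (ℝ × (-∞, x₀]) = 0`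
(see `intensity_rectangle` and `intensity_lower`). -/
noncomputable def intensity (F : ℝ → ℝ) : Measure (ℝ × ℝ) :=
  (volume : Measure ℝ).prod (tailMeasure F)

theorem quantileExp_le_iff (F : StieltjesFunction ℝ) (h0 : Tendsto F atBot (𝓝 0))
    (h1 : Tendsto F atTop (𝓝 1)) {s : ℝ} (hs : 0 < s) (x : ℝ) :
    quantileExp F s ≤ x ↔ Real.exp (-s) ≤ F x := by
  have hne : ({x : ℝ | Real.exp (-s) ≤ F x}).Nonempty := by
    have : Real.exp (-s) < 1 := by simpa using hs
    obtain ⟨y, hy⟩ := (h1.eventually (lt_mem_nhds this)).exists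
    exact ⟨y, le_of_lt hy⟩
  have hbdd : BddBelow {x : ℝ | Real.exp (-s) ≤ F x} := by
    obtain ⟨y, hy⟩ := (h0.eventually (gt_mem_nhds (Real.exp_pos (-s)))).exists
    refine ⟨y, fun z hz => ?_⟩
    by_contra! hlt
    exact absurd (lt_of_le_of_lt (le_trans hz (F.mono hlt.le)) hy) (lt_irrefl _)
  constructor
  · intro h
    have key : ∀ y, x < y → Real.exp (-s) ≤ F y := by
      intro y hy
      obtain ⟨z, hz, hzy⟩ := exists_lt_of_csInf_lt hne (lt_of_le_of_lt h hy)
      exact le_trans hz (F.mono hzy.le)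
    have hc : Tendsto F (𝓝[>] x) (𝓝 (F x)) :=
      (F.right_continuous x).tendsto.mono_left (nhdsWithin_mono _ Ioi_subset_Ici_self)
    exact ge_of_tendsto hc (by filter_upwards [self_mem_nhdsWithin] with y hy using key y hy)
  · intro h
    exact csInf_le hbdd h

theorem aemeasurable_quantileExp (F : StieltjesFunction ℝ) (h0 : Tendsto F atBot (𝓝 0))
    (h1 : Tendsto F atTop (𝓝 1)) :
    AEMeasurable (quantileExp F) (volume.restrict (Ioi (0 : ℝ))) := by
  refine aemeasurable_restrict_of_antitoneOn measurableSet_Ioi ?_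
  intro s hs t ht hst
  rw [quantileExp_le_iff F h0 h1 ht]
  exact le_trans (Real.exp_le_exp.2 (by linarith))
    ((quantileExp_le_iff F h0 h1 hs _).1 le_rfl)

theorem tailMeasure_Ioi (F : StieltjesFunction ℝ) (h0 : Tendsto F atBot (𝓝 0))
    (h1 : Tendsto F atTop (𝓝 1)) {x : ℝ} (hx : 0 < F x) :
    tailMeasure F (Ioi x) = ENNReal.ofReal (-Real.log (F x)) := by
  rw [tailMeasure, Measure.map_apply_of_aemeasurable (aemeasurable_quantileExp F h0 h1)
    measurableSet_Ioi, Measure.restrict_apply' measurableSet_Ioi]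
  have : quantileExp F ⁻¹' Ioi x ∩ Ioi 0 = Ioo 0 (-Real.log (F x)) := by
    ext s
    simp only [mem_inter_iff, mem_preimage, mem_Ioi, mem_Ioo]
    rw [and_comm]
    refine and_congr_right fun hs => ?_
    rw [← not_le, quantileExp_le_iff F h0 h1 hs, not_le, ← Real.log_lt_log_iff hx (Real.exp_pos _),
      Real.log_exp]
    constructor <;> intro h <;> linarith
  rw [this, Real.volume_Ioo, sub_zero]

theorem tailMeasure_Iic (F : StieltjesFunction ℝ) (h0 : Tendsto F atBot (𝓝 0))
    (h1 : Tendsto F atTop (𝓝 1)) {x : ℝ} (hx : F x = 0) : tailMeasure F (Iic x) = 0 := by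
  rw [tailMeasure, Measure.map_apply_of_aemeasurable (aemeasurable_quantileExp F h0 h1)
    measurableSet_Iic, Measure.restrict_apply' measurableSet_Ioi]
  have : quantileExp F ⁻¹' Iic x ∩ Ioi 0 = ∅ := by
    ext s
    simp only [mem_inter_iff, mem_preimage, mem_Ioi, mem_Iic, mem_empty_iff_false, iff_false]
    rintro ⟨h, hs⟩
    rw [quantileExp_le_iff F h0 h1 hs, hx] at h
    exact absurd h (not_le.2 (Real.exp_pos _))
  rw [this, measure_empty]

theorem intensity_rectangle (F : StieltjesFunction ℝ) (h0 : Tendsto F atBot (𝓝 0))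
    (h1 : Tendsto F atTop (𝓝 1)) {a b x : ℝ} (hab : a < b) (hx : 0 < F x) :
    intensity F (Ioo a b ×ˢ Ioi x) = ENNReal.ofReal ((a - b) * Real.log (F x)) := by
  have : SFinite (tailMeasure F) := by unfold tailMeasure; infer_instance
  rw [intensity, Measure.prod_prod, tailMeasure_Ioi F h0 h1 hx, Real.volume_Ioo,
    ← ENNReal.ofReal_mul (by linarith)]
  congr 1
  ring

theorem intensity_lower (F : StieltjesFunction ℝ) (h0 : Tendsto F atBot (𝓝 0))
    (h1 : Tendsto F atTop (𝓝 1)) {x : ℝ} (hx : F x = 0) :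
    intensity F (univ ×ˢ Iic x) = 0 := by
  have : SFinite (tailMeasure F) := by unfold tailMeasure; infer_instance
  rw [intensity, Measure.prod_prod, tailMeasure_Iic F h0 h1 hx, mul_zero]

/-- `N` is a Poisson point process on `E` with intensity measure `Λ`, defined on the probability
space `(Ω, P)`: `N ω` is the counting measure of an at most countable collection of points, the
number `N B` of points in a measurable set `B` is a random variable that is Poisson distributed
with mean `Λ B` (a.s. infinite if `Λ B = ∞`), and the numbers of points in finitely many
pairwise disjoint measurable sets are independent. -/
structure IsPoissonPointProcess {Ω E : Type*} [MeasurableSpace Ω] [MeasurableSpace E]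
    (N : Ω → Measure E) (Λ : Measure E) (P : Measure Ω) : Prop where
  counting : ∀ ω, ∃ (I : Set ℕ) (p : I → E), N ω = Measure.sum fun i => Measure.dirac (p i)
  measurable : ∀ B, MeasurableSet B → Measurable fun ω => N ω B
  poisson : ∀ B, MeasurableSet B → Λ B ≠ ∞ →
    P.map (fun ω => N ω B) = (poissonMeasure (Λ B).toNNReal).map fun k : ℕ => (k : ℝ≥0∞)
  infinite : ∀ B, MeasurableSet B → Λ B = ∞ → ∀ᵐ ω ∂P, N ω B = ∞
  indep : ∀ (ι : Type) [Finite ι] (B : ι → Set E), (∀ i, MeasurableSet (B i)) →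
    Pairwise (Function.onFun Disjoint B) → iIndepFun (fun i ω => N ω (B i)) P

/-- `L(B) = inf {x ∈ ℝ : m (B × (x, ∞)) = 0}`, an extended real number. -/
noncomputable def level (m : Measure (ℝ × ℝ)) (B : Set ℝ) : EReal :=
  sInf ((fun x : ℝ => (x : EReal)) '' {x : ℝ | m (B ×ˢ Ioi x) = 0})

/-- The extremal process `M_t = L((0, t])`. -/
noncomputable def extremal {Ω : Type*} (N : Ω → Measure (ℝ × ℝ)) (t : ℝ) (ω : Ω) : EReal :=
  level (N ω) (Ioc 0 t)

/-- The event that `M_t > b_t` eventually, i.e. for all sufficiently large `t`. -/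
def eventuallyAbove {Ω : Type*} (N : Ω → Measure (ℝ × ℝ)) (b : ℝ → ℝ) : Set Ω :=
  {ω | ∀ᶠ t : ℝ in atTop, (b t : EReal) < extremal N t ω}

/-- `g_t = 1 - F(b_t)`. -/
def tailAt (F b : ℝ → ℝ) (t : ℝ) : ℝ := 1 - F (b t)

/-- `J(b) = ∫_0^∞ g_t e^{-t g_t} dt`, as an element of `[0, ∞]`. -/
noncomputable def J (F b : ℝ → ℝ) : ℝ≥0∞ :=
  ∫⁻ t in Ioi (0 : ℝ), ENNReal.ofReal (tailAt F b t * Real.exp (-(t * tailAt F b t)))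

end ExtremalProcess

namespace ExtremalProcess

/-! `M_t > b_t` says that (0, t] × (b_t, ∞) carries a point, so everything concerns the void events
A_t that it carries none. While F(b_t) > 0, A_t has probability exp(-t k_t) with k_t = -ln F(b_t),
and g_t ≤ k_t ≤ 2 g_t once g_t ≤ 1/2. Since g is antitone on [0, ∞) it has a limit c ≥ 0. The
resulting cases are exhaustive and each is decided almost surely, so the zero-one law follows from
the case analysis.

If c > 0, the levels above the whole boundary have mass at least c and are hit almost surely
(`ae_mem_eventuallyAbove_of_tendsto_pos`).

If g → 0 and t g_t → ∞, void events come in clumps of duration about 1/g, so the sum of their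
probabilities is the wrong quantity. The end of a clump, void up to n followed by a point in (n,
n+1], has probability at most g e^{-ng}. If J < ∞, Borel–Cantelli leaves finitely many ends, and no
clump lasts forever (`ae_eventually_ne_zero_of_exits`). If J = ∞, giving A_n the weight g_n
compensates for the clumping: the weighted count has diverging mean m and second moment (1 + o(1))
m², so void events occur after every time (`exists_void_of_not_summable`, via
`ae_exists_mem_of_second_moment`).

If g → 0 but t g_t does not tend to infinity, void probabilities stay bounded below along a sequence
of times, which can be chosen so sparse that the events are nearly independent
(`exists_void_of_frequently_lt`). -/

theorem lt_level_iff (m : Measure (ℝ × ℝ)) (B : Set ℝ) (x : ℝ) :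
    (x : EReal) < level m B ↔ m (B ×ˢ Ioi x) ≠ 0 := by
  constructor
  · intro h h0
    have hle : level m B ≤ x := sInf_le ⟨x, h0, rfl⟩
    exact absurd hle (not_le.2 h)
  · intro h
    -- Strictness needs a gap: some half-line shifted by 1/(n+1) already has positive mass, and its
    -- endpoint bounds the level from below.
    have hU : B ×ˢ Ioi x = ⋃ n : ℕ, B ×ˢ Ioi (x + 1 / ((n : ℝ) + 1)) := by
      ext ⟨s, y⟩
      simp only [mem_prod, mem_Ioi, mem_iUnion]
      constructor
      · rintro ⟨hs, hy⟩
        obtain ⟨n, hn⟩ := exists_nat_one_div_lt (sub_pos.2 hy)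
        exact ⟨n, hs, by linarith⟩
      · rintro ⟨n, hs, hy⟩
        have : (0 : ℝ) < 1 / ((n : ℝ) + 1) := by positivity
        exact ⟨hs, by linarith⟩
    rw [hU, Ne, measure_iUnion_null_iff] at h
    push Not at h
    obtain ⟨n, hn⟩ := h
    have hpos : (0 : ℝ) < 1 / ((n : ℝ) + 1) := by positivity
    refine lt_of_lt_of_le (b := ((x + 1 / ((n : ℝ) + 1) : ℝ) : EReal))
      (EReal.coe_lt_coe_iff.2 (by linarith)) (le_sInf ?_)
    rintro _ ⟨y, hy, rfl⟩
    refine EReal.coe_le_coe_iff.2 ?_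
    by_contra! hlt
    exact hn (measure_mono_null (prod_mono subset_rfl (Ioi_subset_Ioi hlt.le)) hy)

variable {Ω : Type*} [MeasurableSpace Ω] {P : Measure Ω}

theorem mem_eventuallyAbove_iff {Ω : Type*} (N : Ω → Measure (ℝ × ℝ)) (b : ℝ → ℝ) (ω : Ω) :
    ω ∈ eventuallyAbove N b ↔ ∀ᶠ t : ℝ in atTop, N ω (Ioc 0 t ×ˢ Ioi (b t)) ≠ 0 := by
  simp only [eventuallyAbove, extremal, mem_ofPred_eq, lt_level_iff]

/-! ### Void probabilities and independence -/

section Void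

variable {E : Type*} [MeasurableSpace E] {N : Ω → Measure E} {Λ : Measure E}

theorem IsPoissonPointProcess.measurableSet_void (hN : IsPoissonPointProcess N Λ P) {B : Set E}
    (hB : MeasurableSet B) : MeasurableSet {ω | N ω B = 0} :=
  hN.measurable B hB (measurableSet_singleton 0)

theorem IsPoissonPointProcess.measure_void (hN : IsPoissonPointProcess N Λ P) {B : Set E}
    (hB : MeasurableSet B) (hfin : Λ B ≠ ∞) :
    P {ω | N ω B = 0} = ENNReal.ofReal (Real.exp (-(Λ B).toReal)) := by
  have h := congrArg (fun m => m {0}) (hN.poisson B hB hfin)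
  beta_reduce at h
  rw [Measure.map_apply (hN.measurable B hB) (measurableSet_singleton 0),
    Measure.map_apply (measurable_from_top) (measurableSet_singleton 0)] at h
  have hpre : ((fun k : ℕ => (k : ℝ≥0∞)) ⁻¹' {0}) = {0} := by ext; simp
  rw [hpre, poissonMeasure_singleton] at h
  rw [show {ω | N ω B = 0} = (fun ω => N ω B) ⁻¹' {0} from rfl, h]
  simp [ENNReal.coe_toNNReal_eq_toReal]

theorem IsPoissonPointProcess.measureReal_void (hN : IsPoissonPointProcess N Λ P) {B : Set E}
    (hB : MeasurableSet B) {r : ℝ} (hr : 0 ≤ r) (h : Λ B = ENNReal.ofReal r) :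
    P.real {ω | N ω B = 0} = Real.exp (-r) := by
  rw [Measure.real, hN.measure_void hB (by rw [h]; exact ENNReal.ofReal_ne_top), h,
    ENNReal.toReal_ofReal hr, ENNReal.toReal_ofReal (Real.exp_pos _).le]

theorem IsPoissonPointProcess.measure_void_le (hN : IsPoissonPointProcess N Λ P) {B : Set E}
    (hB : MeasurableSet B) {r : ℝ} (h : ENNReal.ofReal r ≤ Λ B) :
    P {ω | N ω B = 0} ≤ ENNReal.ofReal (Real.exp (-r)) := by
  by_cases hfin : Λ B = ∞
  · have : P {ω | N ω B = 0} = 0 := by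
      refine measure_mono_null ?_ (hN.infinite B hB hfin)
      intro ω hω h'
      rw [mem_ofPred_eq] at hω
      simp [hω] at h'
    simp [this]
  · rw [hN.measure_void hB hfin]
    refine ENNReal.ofReal_le_ofReal (Real.exp_le_exp.2 (neg_le_neg ?_))
    exact (ENNReal.ofReal_le_iff_le_toReal hfin).1 h

theorem IsPoissonPointProcess.indepFun (hN : IsPoissonPointProcess N Λ P) {B C : Set E}
    (hB : MeasurableSet B) (hC : MeasurableSet C) (hBC : Disjoint B C) :
    IndepFun (fun ω => N ω B) (fun ω => N ω C) P := by
  have h := hN.indep Bool (fun i => if i then B else C)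
    (by rintro (_ | _) <;> simpa) (by
      rintro (_ | _) (_ | _) hij
      · exact absurd rfl hij
      · simpa [Function.onFun] using hBC.symm
      · simpa [Function.onFun] using hBC
      · exact absurd rfl hij)
  simpa using h.indepFun (i := true) (j := false) (by simp)

theorem IsPoissonPointProcess.measureReal_inter (hN : IsPoissonPointProcess N Λ P) {B C : Set E}
    (hB : MeasurableSet B) (hC : MeasurableSet C) (hBC : Disjoint B C) {s t : Set ℝ≥0∞}
    (hs : MeasurableSet s) (ht : MeasurableSet t) :
    P.real ({ω | N ω B ∈ s} ∩ {ω | N ω C ∈ t}) =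
      P.real {ω | N ω B ∈ s} * P.real {ω | N ω C ∈ t} := by
  have := (hN.indepFun hB hC hBC).measure_inter_preimage_eq_mul s t hs ht
  simp only [Measure.real]
  rw [← ENNReal.toReal_mul]
  exact congrArg _ this

end Void

/-- A weighted second moment criterion: if the weighted number of occurrences has diverging
expectation `m` and second moment at most `C m + (1 + ε) m²` for each `ε`, then almost surely one of
the events occurs. -/
theorem ae_exists_mem_of_second_moment [IsProbabilityMeasure P] {A : ℕ → Set Ω}
    (hA : ∀ i, MeasurableSet (A i)) {w : ℕ → ℝ}
    (hm : Tendsto (fun K : ℕ => ∑ i ∈ Finset.range K, w i * P.real (A i)) atTop atTop)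
    (h2 : ∀ ε > 0, ∃ C : ℝ, ∃ u : ℕ → ℕ → ℝ, (∀ i j, 0 ≤ u i j) ∧
      (∀ i j, i ≤ j → w i * w j * P.real (A i ∩ A j) ≤
        u i j + (1 + ε) * ((w i * P.real (A i)) * (w j * P.real (A j)))) ∧
      ∀ K, ∑ i ∈ Finset.range K, ∑ j ∈ Finset.range K, u i j ≤
        C * ∑ i ∈ Finset.range K, w i * P.real (A i)) :
    ∀ᵐ ω ∂P, ∃ i, ω ∈ A i := by
  -- For the weighted count X, the variable 2lX - l²X² is at most 1 because (1 - lX)² ≥ 0, and it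
  -- vanishes off the union. Its mean is thus a lower bound for the probability of the union, for
  -- every l.
  have key : ∀ (K : ℕ) (l : ℝ),
      2 * l * ∑ i ∈ Finset.range K, w i * P.real (A i) - l ^ 2 *
        ∑ i ∈ Finset.range K, ∑ j ∈ Finset.range K, w i * w j * P.real (A i ∩ A j) ≤
      P.real (⋃ i, A i) := by
    intro K l
    set X : Ω → ℝ := fun ω => ∑ i ∈ Finset.range K, w i * (A i).indicator 1 ω with hX
    have hint : ∀ s : Set Ω, MeasurableSet s → Integrable (s.indicator (1 : Ω → ℝ)) P :=
      fun s hs => (integrable_const (1 : ℝ)).indicator hs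
    have hXi : Integrable X P := integrable_finsetSum _ fun i _ => (hint _ (hA i)).const_mul _
    have hX2 : (fun ω => X ω ^ 2) = fun ω => ∑ i ∈ Finset.range K, ∑ j ∈ Finset.range K,
        w i * w j * (A i ∩ A j).indicator 1 ω := by
      funext ω
      simp only [hX, sq, Finset.sum_mul_sum]
      refine Finset.sum_congr rfl fun i _ => Finset.sum_congr rfl fun j _ => ?_
      rw [Set.inter_indicator_one, Pi.mul_apply]
      ring
    have hX2i : Integrable (fun ω => X ω ^ 2) P := by
      rw [hX2]
      exact integrable_finsetSum _ fun i _ => integrable_finsetSum _ fun j _ =>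
        (hint _ ((hA i).inter (hA j))).const_mul _
    have e1 : ∫ ω, X ω ∂P = ∑ i ∈ Finset.range K, w i * P.real (A i) := by
      rw [integral_finsetSum _ fun i _ => (hint _ (hA i)).const_mul _]
      refine Finset.sum_congr rfl fun i _ => ?_
      rw [integral_const_mul, integral_indicator_one (hA i)]
    have e2 : ∫ ω, X ω ^ 2 ∂P =
        ∑ i ∈ Finset.range K, ∑ j ∈ Finset.range K, w i * w j * P.real (A i ∩ A j) := by
      rw [hX2, integral_finsetSum _ fun i _ => integrable_finsetSum _ fun j _ =>
        (hint _ ((hA i).inter (hA j))).const_mul _]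
      refine Finset.sum_congr rfl fun i _ => ?_
      rw [integral_finsetSum _ fun j _ => (hint _ ((hA i).inter (hA j))).const_mul _]
      refine Finset.sum_congr rfl fun j _ => ?_
      rw [integral_const_mul, integral_indicator_one ((hA i).inter (hA j))]
    have hUm : MeasurableSet (⋃ i, A i) := MeasurableSet.iUnion hA
    rw [← e1, ← e2, ← integral_indicator_one hUm, ← integral_const_mul, ← integral_const_mul,
      ← integral_sub (hXi.const_mul _) (hX2i.const_mul _)]
    refine integral_mono ((hXi.const_mul _).sub (hX2i.const_mul _)) (hint _ hUm) fun ω => ?_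
    by_cases hω : ω ∈ ⋃ i, A i
    · simp only [Set.indicator_of_mem hω, Pi.one_apply]
      nlinarith [sq_nonneg (1 - l * X ω)]
    · have : X ω = 0 := Finset.sum_eq_zero fun i _ => by
        rw [Set.indicator_of_notMem (fun h => hω (mem_iUnion.2 ⟨i, h⟩)), mul_zero]
      simp [Set.indicator_of_notMem hω, this]
  set m : ℕ → ℝ := fun K => ∑ i ∈ Finset.range K, w i * P.real (A i) with hmdef
  have lower : ∀ ε > 0, 1 / (1 + ε) ≤ P.real (⋃ i, A i) := by
    intro ε hε
    obtain ⟨C, u, hu0, hu, huC⟩ := h2 ε hε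
    have bound : ∀ K, ∑ i ∈ Finset.range K, ∑ j ∈ Finset.range K,
        w i * w j * P.real (A i ∩ A j) ≤ 2 * C * m K + (1 + ε) * m K ^ 2 := by
      intro K
      -- The hypothesis covers only i ≤ j; symmetrising `u` handles both orders and doubles `C`.
      have hpt : ∀ i j, w i * w j * P.real (A i ∩ A j) ≤
          u i j + u j i + (1 + ε) * ((w i * P.real (A i)) * (w j * P.real (A j))) := by
        intro i j
        rcases le_total i j with hij | hij
        · linarith [hu i j hij, hu0 j i]
        · have := hu j i hij
          rw [inter_comm] at this
          linarith [hu0 i j]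
      refine (Finset.sum_le_sum fun i _ => Finset.sum_le_sum fun j _ => hpt i j).trans ?_
      simp only [Finset.sum_add_distrib, ← Finset.mul_sum]
      rw [Finset.sum_comm (f := fun i j => u j i), ← Finset.sum_mul]
      have := huC K
      simp only [hmdef]
      nlinarith
    have hlim : Tendsto (fun K => 1 / (1 + ε) - 2 * C / (1 + ε) ^ 2 * (m K)⁻¹) atTop
        (𝓝 (1 / (1 + ε) - 2 * C / (1 + ε) ^ 2 * 0)) :=
      tendsto_const_nhds.sub ((tendsto_inv_atTop_zero.comp hm).const_mul _)
    rw [mul_zero, sub_zero] at hlim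
    refine le_of_tendsto hlim ?_
    filter_upwards [hm.eventually_gt_atTop 0] with K hK
    -- This l maximises 2lm - l²(1 + ε)m², with value 1/(1 + ε); the remaining term is of order 1/m.
    refine le_trans ?_ (key K (1 / ((1 + ε) * m K)))
    have := mul_le_mul_of_nonneg_left (bound K) (sq_nonneg (1 / ((1 + ε) * m K)))
    refine le_trans (le_of_eq ?_) (sub_le_sub_left this _)
    change _ = 2 * _ * m K - _
    have hε' : (1 + ε) ≠ 0 := by positivity
    field_simp
    ring
  have hlim : Tendsto (fun ε : ℝ => 1 / (1 + ε)) (𝓝[>] 0) (𝓝 (1 / (1 + 0))) := by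
    refine Tendsto.mono_left ?_ nhdsWithin_le_nhds
    exact (tendsto_const_nhds.div (tendsto_const_nhds.add tendsto_id) (by norm_num))
  rw [add_zero, div_one] at hlim
  have hone : 1 ≤ P.real (⋃ i, A i) :=
    le_of_tendsto hlim (by filter_upwards [self_mem_nhdsWithin] with ε hε using lower ε hε)
  have hae : (⋃ i, A i) ∈ ae P := by
    rw [mem_ae_iff_prob_eq_one (MeasurableSet.iUnion hA), ← ofReal_measureReal,
      le_antisymm measureReal_le_one hone, ENNReal.ofReal_one]
  filter_upwards [hae] with ω hω using mem_iUnion.1 hω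

theorem intensity_Ioc_prod (F : ℝ → ℝ) (s t : ℝ) (S : Set ℝ) :
    intensity F (Ioc s t ×ˢ S) = ENNReal.ofReal (t - s) * tailMeasure F S := by
  have : SFinite (tailMeasure F) := by unfold tailMeasure; infer_instance
  rw [intensity, Measure.prod_prod, Real.volume_Ioc]

/-! ### Rectangles, positive limit, and Borel–Cantelli for exits -/

section Distribution

variable {F : StieltjesFunction ℝ}

theorem le_one_of_tendsto_atTop (hF1 : Tendsto F atTop (𝓝 1)) (x : ℝ) : F x ≤ 1 :=
  F.mono.ge_of_tendsto hF1 x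

theorem nonneg_of_tendsto_atBot (hF0 : Tendsto F atBot (𝓝 0)) (x : ℝ) : 0 ≤ F x :=
  F.mono.le_of_tendsto hF0 x

theorem neg_log_nonneg (hF1 : Tendsto F atTop (𝓝 1)) {x : ℝ} (hx : 0 < F x) :
    0 ≤ -Real.log (F x) :=
  neg_nonneg.2 (Real.log_nonpos hx.le (le_one_of_tendsto_atTop hF1 x))

variable {N : Ω → Measure (ℝ × ℝ)}

theorem measureReal_void_rectangle (hF0 : Tendsto F atBot (𝓝 0)) (hF1 : Tendsto F atTop (𝓝 1))
    (hN : IsPoissonPointProcess N (intensity F) P) {s t x : ℝ} (hst : s ≤ t) (hx : 0 < F x) :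
    P.real {ω | N ω (Ioc s t ×ˢ Ioi x) = 0} = Real.exp (-((t - s) * -Real.log (F x))) := by
  refine hN.measureReal_void (measurableSet_Ioc.prod measurableSet_Ioi)
    (mul_nonneg (sub_nonneg.2 hst) (neg_log_nonneg hF1 hx)) ?_
  rw [intensity_Ioc_prod, tailMeasure_Ioi F hF0 hF1 hx, ENNReal.ofReal_mul (sub_nonneg.2 hst)]

/-- As x ≤ y, the union of the two rectangles is the disjoint union of (0, s] × (x, ∞) and (s, t] ×
(y, ∞), whose counts are independent. -/
theorem measureReal_void_inter_void (hF0 : Tendsto F atBot (𝓝 0)) (hF1 : Tendsto F atTop (𝓝 1))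
    (hN : IsPoissonPointProcess N (intensity F) P) {s t x y : ℝ} (hs : 0 ≤ s) (hst : s ≤ t)
    (hxy : x ≤ y) (hx : 0 < F x) :
    P.real ({ω | N ω (Ioc 0 s ×ˢ Ioi x) = 0} ∩ {ω | N ω (Ioc 0 t ×ˢ Ioi y) = 0}) =
      Real.exp (-(s * -Real.log (F x)) - (t - s) * -Real.log (F y)) := by
  have hset : {ω | N ω (Ioc 0 s ×ˢ Ioi x) = 0} ∩ {ω | N ω (Ioc 0 t ×ˢ Ioi y) = 0} =
      {ω | N ω (Ioc 0 s ×ˢ Ioi x) ∈ ({0} : Set ℝ≥0∞)} ∩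
        {ω | N ω (Ioc s t ×ˢ Ioi y) ∈ ({0} : Set ℝ≥0∞)} := by
    ext ω
    refine and_congr_right fun (h1 : N ω _ = 0) => ?_
    have hsub : Ioc s t ×ˢ Ioi y ⊆ Ioc 0 t ×ˢ Ioi y :=
      prod_mono (Ioc_subset_Ioc_left hs) subset_rfl
    refine ⟨fun h2 => measure_mono_null hsub h2, fun h2 => ?_⟩
    refine measure_mono_null ?_ (measure_union_null h1 h2)
    rintro ⟨r, z⟩ ⟨⟨hr0, hrt⟩, hz⟩
    rcases le_or_gt r s with hr | hr
    · exact Or.inl ⟨⟨hr0, hr⟩, lt_of_le_of_lt hxy hz⟩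
    · exact Or.inr ⟨⟨hr, hrt⟩, hz⟩
  have hdisj : Disjoint (Ioc 0 s ×ˢ Ioi x) (Ioc s t ×ˢ Ioi y) :=
    Disjoint.set_prod_left (Ioc_disjoint_Ioc_of_le le_rfl) _ _
  rw [hset, hN.measureReal_inter (measurableSet_Ioc.prod measurableSet_Ioi)
    (measurableSet_Ioc.prod measurableSet_Ioi) hdisj (measurableSet_singleton 0)
    (measurableSet_singleton 0)]
  simp only [mem_singleton_iff]
  rw [measureReal_void_rectangle hF0 hF1 hN hs hx,
    measureReal_void_rectangle hF0 hF1 hN hst (hx.trans_le (F.mono hxy)), ← Real.exp_add]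
  congr 1
  ring

/-- For 0 < s < c the quantile Q(s) satisfies F(Q(s)) ≥ e^{-s} ≥ 1 - s > 1 - c, so Q maps (0, c)
into `S`. This form also covers sets of infinite mass. -/
theorem ofReal_le_tailMeasure (hF0 : Tendsto F atBot (𝓝 0)) (hF1 : Tendsto F atTop (𝓝 1))
    {c : ℝ} {S : Set ℝ} (hS : MeasurableSet S) (h : ∀ x, 1 - c < F x → x ∈ S) :
    ENNReal.ofReal c ≤ tailMeasure F S := by
  rw [tailMeasure, Measure.map_apply_of_aemeasurable (aemeasurable_quantileExp F hF0 hF1) hS,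
    Measure.restrict_apply' measurableSet_Ioi]
  have : ENNReal.ofReal c = volume (Ioo 0 c) := by rw [Real.volume_Ioo, sub_zero]
  rw [this]
  refine measure_mono fun s hs => ⟨h _ ?_, hs.1⟩
  have h1 := (quantileExp_le_iff F hF0 hF1 hs.1 _).1 le_rfl
  have h2 := Real.add_one_le_exp (-s)
  linarith [hs.2]

theorem ae_mem_eventuallyAbove_of_tendsto_pos [IsProbabilityMeasure P]
    (hF0 : Tendsto F atBot (𝓝 0)) (hF1 : Tendsto F atTop (𝓝 1))
    (hN : IsPoissonPointProcess N (intensity F) P) {b : ℝ → ℝ} (hb : MonotoneOn b (Ici 0))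
    {c : ℝ} (hc : 0 < c) (h : Tendsto (tailAt F b) atTop (𝓝 c)) :
    ∀ᵐ ω ∂P, ω ∈ eventuallyAbove N b := by
  have hle : ∀ t, 0 ≤ t → F (b t) ≤ 1 - c := by
    intro t ht
    have : c ≤ tailAt F b t := by
      refine le_of_tendsto h ?_
      filter_upwards [eventually_ge_atTop t] with s hs
      exact sub_le_sub_left (F.mono (hb ht (ht.trans hs) hs)) 1
    unfold tailAt at this
    linarith
  set S : Set ℝ := {x | ∀ t, 0 ≤ t → b t < x} with hSdef
  have hS : MeasurableSet S := by
    have : S.OrdConnected := ⟨fun x hx y _ z hz t ht => (hx t ht).trans_le hz.1⟩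
    exact this.measurableSet
  have hmass : ENNReal.ofReal c ≤ tailMeasure F S := by
    refine ofReal_le_tailMeasure hF0 hF1 hS fun x hx t ht => ?_
    by_contra! hlt
    exact absurd ((F.mono hlt).trans (hle t ht)) (not_le.2 hx)
  have hnull : P {ω | ∀ n : ℕ, N ω (Ioc (0 : ℝ) n ×ˢ S) = 0} = 0 := by
    have hbound : ∀ n : ℕ, P {ω | ∀ n : ℕ, N ω (Ioc (0 : ℝ) n ×ˢ S) = 0} ≤
        ENNReal.ofReal (Real.exp (-(n * c))) := by
      intro n
      have hsub : {ω | ∀ n : ℕ, N ω (Ioc (0 : ℝ) n ×ˢ S) = 0} ⊆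
          {ω | N ω (Ioc (0 : ℝ) n ×ˢ S) = 0} := fun ω (hω : ∀ n : ℕ, _) => hω n
      refine (measure_mono hsub).trans
        (hN.measure_void_le (measurableSet_Ioc.prod hS) ?_)
      rw [intensity_Ioc_prod, sub_zero, ENNReal.ofReal_mul n.cast_nonneg]
      gcongr
    have hlim : Tendsto (fun n : ℕ => ENNReal.ofReal (Real.exp (-(n * c)))) atTop (𝓝 0) := by
      rw [← ENNReal.ofReal_zero]
      refine ENNReal.tendsto_ofReal (Real.tendsto_exp_neg_atTop_nhds_zero.comp ?_)
      exact tendsto_natCast_atTop_atTop.atTop_mul_const hc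
    exact le_antisymm (ge_of_tendsto' hlim hbound) bot_le
  filter_upwards [compl_mem_ae_iff.2 hnull] with ω hω
  rw [mem_eventuallyAbove_iff]
  have hω' : ¬ ∀ n : ℕ, N ω (Ioc (0 : ℝ) n ×ˢ S) = 0 := hω
  push Not at hω'
  obtain ⟨n, hn⟩ := hω'
  filter_upwards [eventually_ge_atTop (n : ℝ)] with t ht h0
  refine hn (measure_mono_null (prod_mono (Ioc_subset_Ioc_right ht) fun x hx => ?_) h0)
  exact hx t (n.cast_nonneg.trans ht)

/-- If the exits from the events `N ((0, n] × (c n, ∞)) = 0` are summable and these events become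
unlikely, then almost surely only finitely many of them occur. -/
theorem ae_eventually_ne_zero_of_exits (hF0 : Tendsto F atBot (𝓝 0))
    (hF1 : Tendsto F atTop (𝓝 1)) [IsProbabilityMeasure P]
    (hN : IsPoissonPointProcess N (intensity F) P) {c : ℕ → ℝ} (hc : Monotone c)
    (hpos : ∀ᶠ n in atTop, 0 < F (c n))
    (hlim : Tendsto (fun n : ℕ => n * (1 - F (c n))) atTop atTop)
    (hsum : ∑' n : ℕ, ENNReal.ofReal ((1 - F (c n)) * Real.exp (-(n * (1 - F (c n))))) ≠ ∞) :
    ∀ᵐ ω ∂P, ∀ᶠ n : ℕ in atTop, N ω (Ioc (0 : ℝ) n ×ˢ Ioi (c n)) ≠ 0 := by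
  obtain ⟨n₀, hn₀⟩ := eventually_atTop.1 hpos
  have hm : ∀ s t x : ℝ, MeasurableSet (Ioc s t ×ˢ Ioi x) :=
    fun s t x => measurableSet_Ioc.prod measurableSet_Ioi
  have hvoid : ∀ n, n₀ ≤ n → P.real {ω | N ω (Ioc (0 : ℝ) n ×ˢ Ioi (c n)) = 0} ≤
      Real.exp (-(n * (1 - F (c n)))) := by
    intro n hn
    rw [measureReal_void_rectangle hF0 hF1 hN n.cast_nonneg (hn₀ n hn), sub_zero]
    refine Real.exp_le_exp.2 (neg_le_neg (mul_le_mul_of_nonneg_left ?_ n.cast_nonneg))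
    linarith [Real.log_le_sub_one_of_pos (hn₀ n hn)]
  -- The exit at n: no point above `c n` up to time n, then one during (n, n+1]. The two counts are
  -- independent, and the second event has probability exactly 1 - F(c n).
  set E : ℕ → Set Ω := fun n => {ω | N ω (Ioc (0 : ℝ) n ×ˢ Ioi (c n)) ∈ ({0} : Set ℝ≥0∞)} ∩
    {ω | N ω (Ioc (n : ℝ) (n + 1 : ℕ) ×ˢ Ioi (c n)) ∈ ({0}ᶜ : Set ℝ≥0∞)} with hE
  have hEprob : ∀ n, n₀ ≤ n → P (E n) ≤
      ENNReal.ofReal ((1 - F (c n)) * Real.exp (-(n * (1 - F (c n))))) := by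
    intro n hn
    have hle : (n : ℝ) ≤ (n + 1 : ℕ) := by push_cast; linarith
    rw [← ofReal_measureReal]
    refine ENNReal.ofReal_le_ofReal ?_
    rw [hE, hN.measureReal_inter (hm _ _ _) (hm _ _ _)
      (Disjoint.set_prod_left (Ioc_disjoint_Ioc_of_le le_rfl) _ _) (measurableSet_singleton 0)
      (measurableSet_singleton 0).compl, mul_comm]
    have h2 : P.real {ω | N ω (Ioc (n : ℝ) (n + 1 : ℕ) ×ˢ Ioi (c n)) ∈ ({0}ᶜ : Set ℝ≥0∞)} =
        1 - F (c n) := by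
      have := probReal_compl_eq_one_sub (μ := P) (hN.measurableSet_void (hm n (n + 1 : ℕ) (c n)))
      rw [measureReal_void_rectangle hF0 hF1 hN hle (hn₀ n hn)] at this
      refine Eq.trans this ?_
      push_cast
      rw [add_sub_cancel_left, one_mul, neg_neg, Real.exp_log (hn₀ n hn)]
    rw [h2]
    exact mul_le_mul_of_nonneg_left (hvoid n hn)
      (sub_nonneg.2 (le_one_of_tendsto_atTop hF1 _))
  have hE0 : ∀ᵐ ω ∂P, ∀ᶠ n in atTop, ω ∉ E (n + n₀) := by
    refine ae_eventually_notMem (ne_top_of_le_ne_top hsum ?_)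
    refine (ENNReal.tsum_le_tsum fun n => hEprob (n + n₀) (Nat.le_add_left _ _)).trans ?_
    exact ENNReal.tsum_comp_le_tsum_of_injective (add_left_injective n₀)
      (fun n => ENNReal.ofReal ((1 - F (c n)) * Real.exp (-(n * (1 - F (c n))))))
  have hstay : ∀ᵐ ω ∂P, ∀ m : ℕ, ¬ ∀ n, m ≤ n → N ω (Ioc (0 : ℝ) n ×ˢ Ioi (c n)) = 0 := by
    rw [ae_all_iff]
    intro m
    refine (ae_iff).2 ?_
    simp only [not_not]
    have hlim' : Tendsto (fun n : ℕ => ENNReal.ofReal (Real.exp (-(n * (1 - F (c n)))))) atTop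
        (𝓝 0) := by
      rw [← ENNReal.ofReal_zero]
      exact ENNReal.tendsto_ofReal (Real.tendsto_exp_neg_atTop_nhds_zero.comp hlim)
    refine le_antisymm (ge_of_tendsto hlim' ?_) bot_le
    filter_upwards [eventually_ge_atTop m, eventually_ge_atTop n₀] with n hmn hn
    have hsub : {ω | ∀ n : ℕ, m ≤ n → N ω (Ioc (0 : ℝ) n ×ˢ Ioi (c n)) = 0} ⊆
        {ω | N ω (Ioc (0 : ℝ) n ×ˢ Ioi (c n)) = 0} := fun ω (hω : ∀ n : ℕ, _) => hω n hmn
    refine (measure_mono hsub).trans ?_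
    rw [← ofReal_measureReal]
    exact ENNReal.ofReal_le_ofReal (hvoid n hn)
  filter_upwards [hE0, hstay] with ω h1 h2
  obtain ⟨m, hm'⟩ := eventually_atTop.1 h1
  filter_upwards [eventually_ge_atTop (m + n₀)] with n hn h0
  -- Without further exits, emptiness at n propagates to all later times because `c` is monotone,
  -- which contradicts `hstay`.
  refine h2 n fun k hk => ?_
  induction k, hk using Nat.le_induction with
  | base => exact h0
  | succ k hk ih =>
    have hk' : ω ∉ E k := by
      have := hm' (k - n₀) (by omega)
      rwa [Nat.sub_add_cancel (by omega)] at this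
    have hstep : N ω (Ioc (k : ℝ) (k + 1 : ℕ) ×ˢ Ioi (c k)) = 0 := by
      by_contra hne
      exact hk' ⟨ih, hne⟩
    refine measure_mono_null ?_ (measure_union_null ih hstep)
    rintro ⟨r, z⟩ ⟨⟨hr0, hrt⟩, hz⟩
    have hz' : z ∈ Ioi (c k) := lt_of_le_of_lt (hc (Nat.le_succ k)) hz
    rcases le_or_gt r k with hr | hr
    · exact Or.inl ⟨⟨hr0, hr⟩, hz'⟩
    · exact Or.inr ⟨⟨hr, hrt⟩, hz'⟩

end Distribution

/-! ### Elementary inequalities; comparing sums with J -/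

section Estimates

/-- A geometric series of ratio e^{-k/2}, where 1 - e^{-k/2} ≥ (k/2)/(1 + k/2); the sum is at most 2
+ k. -/
theorem sum_range_mul_exp_le {k : ℝ} (hk0 : 0 ≤ k) (hk1 : k ≤ 1) (M : ℕ) :
    ∑ m ∈ Finset.range M, k * Real.exp (-(m * k / 2)) ≤ 3 := by
  set r := Real.exp (-(k / 2)) with hr
  have hterm : ∀ m : ℕ, Real.exp (-(m * k / 2)) = r ^ m := by
    intro m
    rw [hr, ← Real.exp_nat_mul]
    congr 1
    ring
  simp only [hterm, ← Finset.mul_sum]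
  have hgeom := mul_neg_geom_sum r M
  have hr0 : 0 < r := Real.exp_pos _
  have hsum : 0 ≤ ∑ m ∈ Finset.range M, r ^ m := Finset.sum_nonneg fun m _ => (pow_pos hr0 m).le
  have hle : k ≤ 3 * (1 - r) := by
    have h1 : (1 + k / 2) * r ≤ 1 := by
      have h2 := Real.add_one_le_exp (k / 2)
      have h3 : Real.exp (k / 2) * r = 1 := by rw [hr, ← Real.exp_add]; simp
      nlinarith
    nlinarith
  nlinarith [pow_pos hr0 M]

/-- The function y ↦ y e^{-cy} decreases for y ≥ 1/c. This is what makes sums and integrals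
comparable once t g_t ≥ 1. -/
theorem mul_exp_neg_mul_le {x y c : ℝ} (hxy : x ≤ y) (hx : 0 ≤ x) (hc : 1 ≤ c * x) :
    y * Real.exp (-(c * y)) ≤ x * Real.exp (-(c * x)) := by
  have h1 : Real.exp (-(c * x)) = Real.exp (c * (y - x)) * Real.exp (-(c * y)) := by
    rw [← Real.exp_add]
    congr 1
    ring
  rw [h1, ← mul_assoc]
  refine mul_le_mul_of_nonneg_right ?_ (Real.exp_pos _).le
  have h2 := Real.add_one_le_exp (c * (y - x))
  nlinarith [mul_le_mul_of_nonneg_right hc (sub_nonneg.2 hxy)]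

theorem neg_log_one_sub_le {g : ℝ} (h1 : g ≤ 1 / 2) :
    -Real.log (1 - g) ≤ g + 2 * g ^ 2 := by
  have hpos : 0 < 1 - g := by linarith
  have h := Real.log_le_sub_one_of_pos (inv_pos.2 hpos)
  rw [Real.log_inv] at h
  refine h.trans ?_
  rw [sub_le_iff_le_add, inv_le_iff_one_le_mul₀ hpos]
  nlinarith [mul_nonneg (sq_nonneg g) (sub_nonneg.2 h1)]

/-- Passes from the exponent n g of J to the exponent n k of the void probability. If n g² ≤ 1, the
two differ by at most 2. Otherwise e^{-ng} ≤ 24/(ng)⁴ and (ng)⁴ = (n g²)² n² ≥ n², a summable error.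
-/
theorem mul_exp_neg_le_add {g : ℝ} (h0 : 0 ≤ g) (h1 : g ≤ 1 / 2) (n : ℕ) :
    g * Real.exp (-(n * g)) ≤
      Real.exp 2 * (g * Real.exp (-(n * -Real.log (1 - g)))) + 24 * (1 / (n : ℝ) ^ 2) := by
  have hn : (0 : ℝ) ≤ n := n.cast_nonneg
  rcases le_or_gt (n * g ^ 2) 1 with h | h
  · have h2 : Real.exp (-(n * g)) ≤ Real.exp 2 * Real.exp (-(n * -Real.log (1 - g))) := by
      rw [← Real.exp_add]
      refine Real.exp_le_exp.2 ?_
      nlinarith [mul_le_mul_of_nonneg_left (neg_log_one_sub_le h1) hn]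
    have h3 := mul_le_mul_of_nonneg_left h2 h0
    have h4 : 0 ≤ 24 * (1 / (n : ℝ) ^ 2) := by positivity
    linarith
  · have hn0 : (0 : ℝ) < n := by
      rcases hn.lt_or_eq with h' | h'
      · exact h'
      · rw [← h'] at h; norm_num at h
    have h2 := Real.pow_div_factorial_le_exp (n * g) (mul_nonneg hn h0) 4
    have h3 : Real.exp (-(n * g)) ≤ 24 * (1 / (n : ℝ) ^ 2) := by
      rw [Real.exp_neg, inv_le_comm₀ (Real.exp_pos _) (by positivity)]
      refine le_trans ?_ h2
      have h4 : ((Nat.factorial 4 : ℕ) : ℝ) = 24 := by norm_num [Nat.factorial]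
      rw [h4, show (n * g) ^ 4 / 24 = (n * g ^ 2) ^ 2 * n ^ 2 / 24 by ring]
      have h5 : (24 * (1 / (n : ℝ) ^ 2))⁻¹ = 1 ^ 2 * (n : ℝ) ^ 2 / 24 := by
        field_simp
      rw [h5]
      gcongr
    have h4 : g * Real.exp (-(n * g)) ≤ 1 * Real.exp (-(n * g)) :=
      mul_le_mul_of_nonneg_right (by linarith) (Real.exp_pos _).le
    have h5 : 0 ≤ Real.exp 2 * (g * Real.exp (-(n * -Real.log (1 - g)))) := by positivity
    linarith

variable {g : ℝ → ℝ}

theorem tsum_ne_top_of_lintegral_lt_top (hg : AntitoneOn g (Ici 0)) (h0 : ∀ t, 0 ≤ g t)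
    (h1 : ∀ t, g t ≤ 1) (htg : Tendsto (fun t : ℝ => t * g t) atTop atTop)
    (hJ : ∫⁻ t in Ioi (0 : ℝ), ENNReal.ofReal (g t * Real.exp (-(t * g t))) < ∞) :
    ∑' n : ℕ, ENNReal.ofReal (g (n + 1) * Real.exp (-(n * g (n + 1)))) ≠ ∞ := by
  obtain ⟨T, hT⟩ := eventually_atTop.1 (htg.eventually_ge_atTop 1)
  obtain ⟨n₀, hn₀⟩ := exists_nat_ge T
  rw [← ENNReal.summable.sum_add_tsum_nat_add' (k := n₀)]
  refine ENNReal.add_ne_top.2 ⟨(ENNReal.sum_lt_top.2 fun _ _ => ENNReal.ofReal_lt_top).ne, ?_⟩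
  -- The term with g(m+1) is compared with the integral over (m+1, m+2]; replacing m by m+2 in the
  -- exponent costs at most e² since g ≤ 1.
  have hstep : ∀ n : ℕ, ENNReal.ofReal (g ((n + n₀ : ℕ) + 1) *
      Real.exp (-((n + n₀ : ℕ) * g ((n + n₀ : ℕ) + 1)))) ≤ ENNReal.ofReal (Real.exp 2) *
      ∫⁻ t in Ioc (((n + n₀ : ℕ) : ℝ) + 1) ((n + 1 + n₀ : ℕ) + 1),
        ENNReal.ofReal (g t * Real.exp (-(t * g t))) := by
    intro n
    set m : ℕ := n + n₀ with hm
    have hmT : T ≤ m := hn₀.trans (by exact_mod_cast Nat.le_add_left _ _)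
    have hm0 : (0 : ℝ) ≤ m := m.cast_nonneg
    have hvol : volume (Ioc ((m : ℝ) + 1) ((n + 1 + n₀ : ℕ) + 1)) = 1 := by
      rw [Real.volume_Ioc, hm]
      push_cast
      ring_nf
      simp
    calc ENNReal.ofReal (g (m + 1) * Real.exp (-(m * g (m + 1))))
        ≤ ENNReal.ofReal (Real.exp 2 * (g (m + 1) * Real.exp (-((m + 2) * g (m + 1))))) := by
          refine ENNReal.ofReal_le_ofReal ?_
          rw [mul_left_comm, ← Real.exp_add]
          refine mul_le_mul_of_nonneg_left (Real.exp_le_exp.2 ?_) (h0 _)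
          linarith [h1 (m + 1)]
      _ = ENNReal.ofReal (Real.exp 2) * ∫⁻ _t in Ioc ((m : ℝ) + 1) ((n + 1 + n₀ : ℕ) + 1),
            ENNReal.ofReal (g (m + 1) * Real.exp (-((m + 2) * g (m + 1)))) := by
          rw [setLIntegral_const, hvol, mul_one, ENNReal.ofReal_mul (Real.exp_pos _).le]
      _ ≤ _ := by
          refine mul_le_mul_right ?_ _
          refine setLIntegral_mono' measurableSet_Ioc fun t ht => ENNReal.ofReal_le_ofReal ?_
          have ht2 : t ≤ m + 2 := by
            have := ht.2
            rw [hm]; push_cast at this ⊢; linarith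
          have htpos : 0 ≤ t := by linarith [ht.1]
          have hle : g t ≤ g (m + 1) :=
            hg (mem_Ici.2 (by linarith)) (mem_Ici.2 htpos) ht.1.le
          have htg1 : 1 ≤ t * g t := hT t (by linarith [ht.1])
          refine (mul_exp_neg_mul_le hle (h0 t) (c := m + 2) ?_).trans ?_
          · exact htg1.trans (mul_le_mul_of_nonneg_right ht2 (h0 t))
          · refine mul_le_mul_of_nonneg_left (Real.exp_le_exp.2 (neg_le_neg ?_)) (h0 t)
            exact mul_le_mul_of_nonneg_right ht2 (h0 t)
  refine ne_top_of_le_ne_top ?_ (ENNReal.tsum_le_tsum hstep)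
  rw [ENNReal.tsum_mul_left]
  refine ENNReal.mul_ne_top ENNReal.ofReal_ne_top (ne_top_of_le_ne_top hJ.ne ?_)
  have hmono : Monotone fun n : ℕ => ((n + n₀ : ℕ) : ℝ) + 1 := by
    intro a b hab
    dsimp only
    push_cast
    have : (a : ℝ) ≤ b := by exact_mod_cast hab
    linarith
  refine (lintegral_iUnion (fun n => measurableSet_Ioc)
    hmono.pairwise_disjoint_on_Ioc_succ _).symm.le.trans ?_
  refine lintegral_mono_set (iUnion_subset fun n t ht => ?_)
  have : (0 : ℝ) ≤ ((n + n₀ : ℕ) : ℝ) := Nat.cast_nonneg _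
  exact mem_Ioi.2 (by linarith [ht.1])

theorem not_summable_of_lintegral_eq_top (hg : AntitoneOn g (Ici 0)) (h0 : ∀ t, 0 ≤ g t)
    (h1 : ∀ t, g t ≤ 1) (htg : Tendsto (fun t : ℝ => t * g t) atTop atTop)
    (hJ : ∫⁻ t in Ioi (0 : ℝ), ENNReal.ofReal (g t * Real.exp (-(t * g t))) = ∞) :
    ¬ Summable fun n : ℕ => g n * Real.exp (-(n * g n)) := by
  intro hs
  -- The threshold 2 gives m g(m+1) ≥ 2 - g(m+1) ≥ 1, as the monotonicity of y e^{-my} requires.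
  obtain ⟨T, hT⟩ := eventually_atTop.1 (htg.eventually_ge_atTop 2)
  obtain ⟨n₀, hn₀⟩ := exists_nat_ge (max T 1)
  have hcover : Ioi (0 : ℝ) ⊆ Ioc (0 : ℝ) n₀ ∪
      ⋃ n : ℕ, Ioc ((n + n₀ : ℕ) : ℝ) ((n + n₀ + 1 : ℕ) : ℝ) := by
    intro t ht
    rcases le_or_gt t n₀ with h | h
    · exact Or.inl ⟨ht, h⟩
    · right
      have hk1 : n₀ < ⌈t⌉₊ := Nat.lt_ceil.2 h
      refine mem_iUnion.2 ⟨⌈t⌉₊ - 1 - n₀, ?_⟩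
      rw [show ⌈t⌉₊ - 1 - n₀ + n₀ = ⌈t⌉₊ - 1 by omega, show ⌈t⌉₊ - 1 + 1 = ⌈t⌉₊ by omega]
      exact ⟨Nat.lt_ceil.1 (by omega), Nat.le_ceil t⟩
  have hstep : ∀ n : ℕ, ∫⁻ t in Ioc ((n + n₀ : ℕ) : ℝ) ((n + n₀ + 1 : ℕ) : ℝ),
      ENNReal.ofReal (g t * Real.exp (-(t * g t))) ≤ ENNReal.ofReal (Real.exp 1 *
        (g (n + n₀ + 1 : ℕ) * Real.exp (-((n + n₀ + 1 : ℕ) * g (n + n₀ + 1 : ℕ))))) := by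
    intro n
    set m : ℕ := n + n₀ with hm
    have hmT : T ≤ m := (le_max_left _ _).trans
      (hn₀.trans (by exact_mod_cast Nat.le_add_left _ _))
    have hm1 : (1 : ℝ) ≤ m := (le_max_right _ _).trans
      (hn₀.trans (by exact_mod_cast Nat.le_add_left _ _))
    have hvol : volume (Ioc (m : ℝ) (m + 1 : ℕ)) = 1 := by
      rw [Real.volume_Ioc]
      push_cast
      simp
    refine (setLIntegral_mono' (g := fun _ => ENNReal.ofReal (Real.exp 1 *
        (g (m + 1 : ℕ) * Real.exp (-((m + 1 : ℕ) * g (m + 1 : ℕ))))))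
        measurableSet_Ioc fun t ht => ENNReal.ofReal_le_ofReal ?_).trans ?_
    · set x := g (m + 1 : ℕ) with hx
      have hle : x ≤ g t := hg (mem_Ici.2 (by linarith [ht.1])) (mem_Ici.2 (by positivity)) ht.2
      have hx0 : 0 ≤ x := h0 _
      have hx1 : x ≤ 1 := h1 _
      have hX : 2 ≤ ((m + 1 : ℕ) : ℝ) * x := hT _ (by push_cast; linarith)
      push_cast at hX ⊢
      calc g t * Real.exp (-(t * g t)) ≤ g t * Real.exp (-(m * g t)) := by
            refine mul_le_mul_of_nonneg_left (Real.exp_le_exp.2 (neg_le_neg ?_)) (h0 t)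
            exact mul_le_mul_of_nonneg_right ht.1.le (h0 t)
        _ ≤ x * Real.exp (-(m * x)) := mul_exp_neg_mul_le hle hx0 (by linarith)
        _ ≤ Real.exp 1 * (x * Real.exp (-((m + 1) * x))) := by
            rw [mul_left_comm, ← Real.exp_add]
            exact mul_le_mul_of_nonneg_left (Real.exp_le_exp.2 (by linarith)) hx0
    · rw [setLIntegral_const, hvol, mul_one]
  have hhead : ∫⁻ t in Ioc (0 : ℝ) n₀, ENNReal.ofReal (g t * Real.exp (-(t * g t))) < ∞ := by
    refine (setLIntegral_mono' (g := fun _ => 1) measurableSet_Ioc fun t ht => ?_).trans_lt ?_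
    · rw [← ENNReal.ofReal_one]
      refine ENNReal.ofReal_le_ofReal (mul_le_one₀ (h1 t) (Real.exp_pos _).le ?_)
      exact Real.exp_le_one_iff.2 (neg_nonpos.2 (mul_nonneg ht.1.le (h0 t)))
    · rw [setLIntegral_const, one_mul, Real.volume_Ioc]
      exact ENNReal.ofReal_lt_top
  have hs' : Summable fun n : ℕ => Real.exp 1 *
      (g (n + n₀ + 1 : ℕ) * Real.exp (-((n + n₀ + 1 : ℕ) * g (n + n₀ + 1 : ℕ)))) :=
    ((summable_nat_add_iff (n₀ + 1)).2 hs).mul_left _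
  refine absurd hJ (LT.lt.ne ?_)
  calc _ ≤ _ := lintegral_mono_set hcover
    _ ≤ _ := lintegral_union_le _ _ _
    _ ≤ _ := add_le_add_right ((lintegral_iUnion_le _ _).trans (ENNReal.tsum_le_tsum hstep)) _
    _ < ∞ := ENNReal.add_lt_top.2 ⟨hhead, hs'.tsum_ofReal_lt_top⟩

end Estimates

/-! ### Void events at arbitrarily late times -/

section Divergence

variable {F : StieltjesFunction ℝ}
variable {N : Ω → Measure (ℝ × ℝ)}

/-- Three regimes. If kj ≥ ki/2, the factor e^{-d kj} decays geometrically in the gap d at rate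
ki/2. If ti kj ≤ δ, the ratio of joint to product probability is e^{ti kj} ≤ 1 + ε. Otherwise ti (ki
- kj) ≥ ti ki/4 + ti kj/2, and ki e^{-ti ki/4} ≤ 4/ti ≤ 4 kj/δ. The two error terms are to be summed
over j and over i respectively. -/
theorem weighted_joint_probability_le {ki kj wi wj ti d δ ε : ℝ} {i : ℕ} (hδ : 0 < δ)
    (hε : Real.exp δ ≤ 1 + ε) (hwi : 0 ≤ wi) (hwj : 0 ≤ wj) (hwik : wi ≤ ki) (hwjk : wj ≤ kj)
    (hkj : 0 ≤ kj) (hk : kj ≤ ki) (hit : (i : ℝ) ≤ ti) (hd : 0 ≤ d) :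
    wi * wj * Real.exp (-(ti * ki) - d * kj) ≤
      wi * Real.exp (-(ti * ki)) * (ki * Real.exp (-(d * ki / 2))) +
      wj * Real.exp (-((ti + d) * kj)) * (4 / δ * (kj * Real.exp (-(i * kj / 2)))) +
      (1 + ε) * ((wi * Real.exp (-(ti * ki))) * (wj * Real.exp (-((ti + d) * kj)))) := by
  have hki : 0 ≤ ki := hkj.trans hk
  have hε0 : 0 ≤ 1 + ε := (Real.exp_pos δ).le.trans hε
  have hi0 : (0 : ℝ) ≤ i := i.cast_nonneg
  have hti : 0 ≤ ti := hi0.trans hit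
  set a := wi * Real.exp (-(ti * ki)) * (ki * Real.exp (-(d * ki / 2))) with ha
  set b := wj * Real.exp (-((ti + d) * kj)) * (4 / δ * (kj * Real.exp (-(i * kj / 2)))) with hb
  set c := (1 + ε) * ((wi * Real.exp (-(ti * ki))) * (wj * Real.exp (-((ti + d) * kj)))) with hc
  have ha0 : 0 ≤ a := by positivity
  have hb0 : 0 ≤ b := by positivity
  have hc0 : 0 ≤ c := by positivity
  rcases le_or_gt (ki / 2) kj with h | h
  · have : wi * wj * Real.exp (-(ti * ki) - d * kj) ≤ a := by
      rw [sub_eq_add_neg, Real.exp_add, ha]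
      have h1 : wj * Real.exp (-(d * kj)) ≤ ki * Real.exp (-(d * ki / 2)) := by
        refine mul_le_mul (hwjk.trans hk) (Real.exp_le_exp.2 ?_) (Real.exp_pos _).le hki
        nlinarith
      have h2 := mul_le_mul_of_nonneg_left h1 (mul_nonneg hwi (Real.exp_pos (-(ti * ki))).le)
      linarith
    linarith
  rcases le_or_gt (ti * kj) δ with h' | h'
  · have : wi * wj * Real.exp (-(ti * ki) - d * kj) ≤ c := by
      have h1 : Real.exp (-(ti * ki) - d * kj) = Real.exp (ti * kj) *
          (Real.exp (-(ti * ki)) * Real.exp (-((ti + d) * kj))) := by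
        rw [← Real.exp_add, ← Real.exp_add]
        congr 1
        ring
      have h2 : Real.exp (ti * kj) ≤ 1 + ε := (Real.exp_le_exp.2 h').trans hε
      have h3 : 0 ≤ wi * wj * (Real.exp (-(ti * ki)) * Real.exp (-((ti + d) * kj))) := by
        positivity
      rw [h1, hc]
      have h4 := mul_le_mul_of_nonneg_right h2 h3
      linarith
    linarith
  · have : wi * wj * Real.exp (-(ti * ki) - d * kj) ≤ b := by
      have h1 : Real.exp (-(ti * ki) - d * kj) =
          Real.exp (-((ti + d) * kj)) * Real.exp (-(ti * (ki - kj))) := by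
        rw [← Real.exp_add]
        congr 1
        ring
      have h2 : wi * Real.exp (-(ti * (ki - kj))) ≤
          4 / δ * (kj * Real.exp (-(i * kj / 2))) := by
        have e1 : Real.exp (-(ti * (ki - kj))) ≤
            Real.exp (-(ti * ki / 4)) * Real.exp (-(i * kj / 2)) := by
          rw [← Real.exp_add]
          refine Real.exp_le_exp.2 ?_
          have f1 : ti * kj ≤ ti * (ki / 2) := mul_le_mul_of_nonneg_left h.le hti
          have f2 : i * kj ≤ ti * kj := mul_le_mul_of_nonneg_right hit hkj
          linarith
        have e2 : ki * Real.exp (-(ti * ki / 4)) ≤ 4 / δ * kj := by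
          have f1 := Real.add_one_le_exp (ti * ki / 4)
          have f2 : Real.exp (ti * ki / 4) * Real.exp (-(ti * ki / 4)) = 1 := by
            rw [← Real.exp_add]; simp
          have f3 : ti * (ki * Real.exp (-(ti * ki / 4))) ≤ 4 := by
            nlinarith [Real.exp_pos (-(ti * ki / 4))]
          have f5 : 0 ≤ ki * Real.exp (-(ti * ki / 4)) := by positivity
          rw [div_mul_eq_mul_div, le_div_iff₀ hδ]
          nlinarith [mul_le_mul_of_nonneg_right h'.le f5, mul_le_mul_of_nonneg_right f3 hkj]
        calc _ ≤ ki * (Real.exp (-(ti * ki / 4)) * Real.exp (-(i * kj / 2))) :=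
              mul_le_mul hwik e1 (Real.exp_pos _).le hki
          _ = ki * Real.exp (-(ti * ki / 4)) * Real.exp (-(i * kj / 2)) := by ring
          _ ≤ 4 / δ * kj * Real.exp (-(i * kj / 2)) :=
              mul_le_mul_of_nonneg_right e2 (Real.exp_pos _).le
          _ = _ := by ring
      rw [h1, hb]
      have h4 := mul_le_mul_of_nonneg_left h2
        (mul_nonneg hwj (Real.exp_pos (-((ti + d) * kj))).le)
      linarith
    linarith

theorem exists_void_of_not_summable (hF0 : Tendsto F atBot (𝓝 0))
    (hF1 : Tendsto F atTop (𝓝 1)) [IsProbabilityMeasure P]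
    (hN : IsPoissonPointProcess N (intensity F) P) {c : ℕ → ℝ} (hc : Monotone c) {T : ℕ}
    (hpos : ∀ n, T ≤ n → Real.exp (-1) ≤ F (c n))
    (hsum : ¬ Summable fun n : ℕ =>
      (1 - F (c n)) * Real.exp (-(n * -Real.log (F (c n))))) :
    ∀ᵐ ω ∂P, ∃ n, T ≤ n ∧ N ω (Ioc (0 : ℝ) n ×ˢ Ioi (c n)) = 0 := by
  set k : ℕ → ℝ := fun i => -Real.log (F (c (i + T))) with hk
  set w : ℕ → ℝ := fun i => 1 - F (c (i + T)) with hw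
  set t : ℕ → ℝ := fun i => ((i + T : ℕ) : ℝ) with ht
  set A : ℕ → Set Ω := fun i => {ω | N ω (Ioc (0 : ℝ) (t i) ×ˢ Ioi (c (i + T))) = 0} with hA
  have hFpos : ∀ i, 0 < F (c (i + T)) := fun i =>
    (Real.exp_pos _).trans_le (hpos _ (Nat.le_add_left _ _))
  have hk0 : ∀ i, 0 ≤ k i := fun i => neg_log_nonneg hF1 (hFpos i)
  have hk1 : ∀ i, k i ≤ 1 := fun i => by
    have := (Real.le_log_iff_exp_le (hFpos i)).2 (hpos _ (Nat.le_add_left _ _))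
    simp only [hk]
    linarith
  have hkanti : Antitone k := fun i j hij =>
    neg_le_neg (Real.log_le_log (hFpos i) (F.mono (hc (by omega))))
  have hw0 : ∀ i, 0 ≤ w i := fun i => sub_nonneg.2 (le_one_of_tendsto_atTop hF1 _)
  have hwk : ∀ i, w i ≤ k i := fun i => by
    have := Real.log_le_sub_one_of_pos (hFpos i)
    simp only [hk, hw]
    linarith
  have hAm : ∀ i, MeasurableSet (A i) := fun i =>
    hN.measurableSet_void (measurableSet_Ioc.prod measurableSet_Ioi)
  have ht0 : ∀ i, 0 ≤ t i := fun i => Nat.cast_nonneg _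
  have hAp : ∀ i, P.real (A i) = Real.exp (-(t i * k i)) := fun i => by
    rw [hA, measureReal_void_rectangle hF0 hF1 hN (ht0 i) (hFpos i), sub_zero]
  have hAA : ∀ i j, i ≤ j → P.real (A i ∩ A j) =
      Real.exp (-(t i * k i) - ((j - i : ℕ) : ℝ) * k j) := fun i j hij => by
    have hsub : ((j - i : ℕ) : ℝ) = t j - t i := by
      rw [Nat.cast_sub hij]
      simp only [ht]
      push_cast
      ring
    rw [hsub]
    exact measureReal_void_inter_void hF0 hF1 hN (ht0 i)
      (by simp only [ht]; exact_mod_cast Nat.add_le_add_right hij T) (hc (by omega)) (hFpos i)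
  have hae : ∀ᵐ ω ∂P, ∃ i, ω ∈ A i := by
    refine ae_exists_mem_of_second_moment hAm (w := w) ?_ ?_
    · simp only [hAp]
      refine (not_summable_iff_tendsto_nat_atTop_of_nonneg
        fun i => mul_nonneg (hw0 i) (Real.exp_pos _).le).1 ?_
      exact fun h => hsum ((summable_nat_add_iff T).1 h)
    · intro ε hε
      set δ := Real.log (1 + ε) with hδ
      have hδ0 : 0 < δ := Real.log_pos (by linarith)
      have hexp : Real.exp δ ≤ 1 + ε := (Real.exp_log (by linarith)).le
      -- Each error term is one weighted probability times a geometric series bounded by 3 through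
      -- `sum_range_mul_exp_le`.
      refine ⟨3 + 4 / δ * 3, fun i j =>
        (if i ≤ j then w i * P.real (A i) * (k i * Real.exp (-((j - i : ℕ) * k i / 2))) else 0) +
        w j * P.real (A j) * (4 / δ * (k j * Real.exp (-(i * k j / 2)))), ?_, ?_, ?_⟩
      · intro i j
        have := hw0 i
        have := hw0 j
        have := hk0 i
        have := hk0 j
        beta_reduce
        split_ifs <;> positivity
      · intro i j hij
        beta_reduce
        rw [if_pos hij, hAA i j hij, hAp, hAp]
        have hsub : t j = t i + (j - i : ℕ) := by
          rw [Nat.cast_sub hij]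
          simp only [ht]
          push_cast
          ring
        rw [hsub]
        exact weighted_joint_probability_le hδ0 hexp (hw0 i) (hw0 j) (hwk i) (hwk j) (hk0 j)
          (hkanti hij) (by simp only [ht]; exact_mod_cast Nat.le_add_right i T) (Nat.cast_nonneg _)
      · intro K
        simp only [Finset.sum_add_distrib]
        have hp : ∀ i, 0 ≤ w i * P.real (A i) := fun i => mul_nonneg (hw0 i) measureReal_nonneg
        rw [add_mul, Finset.mul_sum, Finset.mul_sum]
        refine add_le_add (Finset.sum_le_sum fun i _ => ?_) ?_
        · rw [← Finset.sum_filter]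
          have hfilter : (Finset.range K).filter (i ≤ ·) = Finset.Ico i K := by
            ext j
            simp only [Finset.mem_filter, Finset.mem_range, Finset.mem_Ico]
            tauto
          rw [hfilter, ← Finset.mul_sum, Finset.sum_Ico_eq_sum_range, mul_comm]
          refine mul_le_mul_of_nonneg_right ?_ (hp i)
          simp only [Nat.add_sub_cancel_left]
          exact sum_range_mul_exp_le (hk0 i) (hk1 i) _
        · rw [Finset.sum_comm]
          refine Finset.sum_le_sum fun j _ => ?_
          rw [← Finset.mul_sum, ← Finset.mul_sum, mul_comm]
          refine mul_le_mul_of_nonneg_right ?_ (hp j)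
          exact mul_le_mul_of_nonneg_left (sum_range_mul_exp_le (hk0 j) (hk1 j) K) (by positivity)
  filter_upwards [hae] with ω ⟨i, hi⟩
  exact ⟨i + T, Nat.le_add_left _ _, hi⟩

/-- Along times with t k t < C each void event has probability at least e^{-C}. For i < j the ratio
of joint to product probability is exp(t_i k(t_j)), and choosing each time late enough after its
predecessor brings this close to 1. -/
theorem exists_void_of_frequently_lt (hF0 : Tendsto F atBot (𝓝 0))
    (hF1 : Tendsto F atTop (𝓝 1)) [IsProbabilityMeasure P]
    (hN : IsPoissonPointProcess N (intensity F) P) {b : ℝ → ℝ} (hb : MonotoneOn b (Ici 0))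
    {k : ℝ → ℝ} (hk : ∀ t, k t = -Real.log (F (b t))) (hk0 : Tendsto k atTop (𝓝 0))
    {C T : ℝ} (hT : 0 ≤ T) (hpos : ∀ t, T ≤ t → 0 < F (b t))
    (hC : ∃ᶠ t in atTop, t * k t < C) :
    ∀ᵐ ω ∂P, ∃ t, T ≤ t ∧ N ω (Ioc (0 : ℝ) t ×ˢ Ioi (b t)) = 0 := by
  have hstep : ∀ (i : ℕ) (s : ℝ), ∃ t, max s T ≤ t ∧ t * k t < C ∧ s * k t ≤ 1 / (i + 1) := by
    intro i s
    have hlim : Tendsto (fun t => s * k t) atTop (𝓝 (s * 0)) := hk0.const_mul s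
    rw [mul_zero] at hlim
    have hev : ∀ᶠ t in atTop, s * k t ≤ 1 / ((i : ℝ) + 1) :=
      hlim.eventually_le_const (by positivity)
    obtain ⟨t, h1, h2, h3⟩ := (hC.and_eventually
      ((eventually_ge_atTop (max s T)).and hev)).exists
    exact ⟨t, h2, h1, h3⟩
  choose f hf using hstep
  set t : ℕ → ℝ := fun n => Nat.rec (f 0 T) (fun i s => f i s) n with ht
  have hsucc : ∀ n, t (n + 1) = f n (t n) := fun n => rfl
  have htT : ∀ n, T ≤ t n := by
    rintro (_ | n)
    · exact (le_max_right _ _).trans (hf 0 T).1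
    · rw [hsucc]
      exact (le_max_right _ _).trans (hf n _).1
  have ht0 : ∀ n, 0 ≤ t n := fun n => hT.trans (htT n)
  have htC : ∀ n, t n * k (t n) < C := by
    rintro (_ | n)
    · exact (hf 0 T).2.1
    · rw [hsucc]
      exact (hf n _).2.1
  have hmono : Monotone t := monotone_nat_of_le_succ fun n => by
    rw [hsucc]
    exact (le_max_left _ _).trans (hf n _).1
  have hbmono : ∀ {i j}, i ≤ j → b (t i) ≤ b (t j) := fun hij =>
    hb (ht0 _) (ht0 _) (hmono hij)
  have hcross : ∀ i j, i < j → t i * k (t j) ≤ 1 / ((i : ℝ) + 1) := by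
    intro i j hij
    refine le_trans (mul_le_mul_of_nonneg_left ?_ (ht0 i)) (hf i (t i)).2.2
    rw [← hsucc, hk, hk]
    exact neg_le_neg (Real.log_le_log (hpos _ (htT (i + 1))) (F.mono (hbmono hij)))
  set A : ℕ → Set Ω := fun i => {ω | N ω (Ioc (0 : ℝ) (t i) ×ˢ Ioi (b (t i))) = 0} with hA
  have hAm : ∀ i, MeasurableSet (A i) := fun i =>
    hN.measurableSet_void (measurableSet_Ioc.prod measurableSet_Ioi)
  have hAp : ∀ i, P.real (A i) = Real.exp (-(t i * k (t i))) := fun i => by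
    rw [hA, measureReal_void_rectangle hF0 hF1 hN (ht0 i) (hpos _ (htT i)), sub_zero, hk]
  have hae : ∀ᵐ ω ∂P, ∃ i, ω ∈ A i := by
    refine ae_exists_mem_of_second_moment hAm (w := fun _ => 1) ?_ ?_
    · have hlin : Tendsto (fun K : ℕ => (K : ℝ) * Real.exp (-C)) atTop atTop :=
        tendsto_natCast_atTop_atTop.atTop_mul_const (Real.exp_pos _)
      refine tendsto_atTop_mono (fun K => ?_) hlin
      calc (K : ℝ) * Real.exp (-C) = ∑ _i ∈ Finset.range K, Real.exp (-C) := by simp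
        _ ≤ _ := Finset.sum_le_sum fun i _ => by
          rw [one_mul, hAp]
          exact Real.exp_le_exp.2 (neg_le_neg (htC i).le)
    · intro ε hε
      have hδ0 : 0 < Real.log (1 + ε) := Real.log_pos (by linarith)
      obtain ⟨I, hI⟩ := exists_nat_one_div_lt hδ0
      -- The error collects the diagonal, contributing 1, and the first `I` rows, where near
      -- independence is not yet available.
      refine ⟨1 + I, fun i j => (if i = j then P.real (A j) else 0) +
        (if i ∈ Finset.range I then P.real (A j) else 0), ?_, ?_, ?_⟩
      · intro i j
        have : 0 ≤ P.real (A j) := measureReal_nonneg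
        beta_reduce
        split_ifs <;> linarith
      · intro i j hij
        beta_reduce
        have hpi : 0 ≤ P.real (A i) := measureReal_nonneg
        have hpj : 0 ≤ P.real (A j) := measureReal_nonneg
        have hprod : 0 ≤ (1 + ε) * (1 * P.real (A i) * (1 * P.real (A j))) := by positivity
        have htriv : P.real (A i ∩ A j) ≤ P.real (A j) := measureReal_mono inter_subset_right
        rcases hij.eq_or_lt with h | h
        · rw [if_pos h]
          split_ifs <;> linarith
        by_cases hiI : i ∈ Finset.range I
        · rw [if_pos hiI]
          split_ifs <;> linarith
        · have hle : t i * k (t j) ≤ Real.log (1 + ε) := by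
            refine (hcross i j h).trans (le_trans ?_ hI.le)
            have : (I : ℝ) ≤ i := by exact_mod_cast not_lt.1 (fun h' => hiI (Finset.mem_range.2 h'))
            exact one_div_le_one_div_of_le (by positivity) (by linarith)
          have hexp : Real.exp (t i * k (t j)) ≤ 1 + ε := by
            rw [← Real.le_log_iff_exp_le (by linarith)]
            exact hle
          have hAA : P.real (A i ∩ A j) =
              Real.exp (t i * k (t j)) * (P.real (A i) * P.real (A j)) := by
            rw [hA, measureReal_void_inter_void hF0 hF1 hN (ht0 i) (hmono hij) (hbmono hij)
              (hpos _ (htT i))]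
            rw [← hk, ← hk]
            change _ = _ * (P.real (A i) * P.real (A j))
            rw [hAp, hAp, ← Real.exp_add, ← Real.exp_add]
            congr 1
            ring
          rw [if_neg h.ne, if_neg hiI, hAA]
          have := mul_le_mul_of_nonneg_right hexp (mul_nonneg hpi hpj)
          linarith
      · intro K
        simp only [Finset.sum_add_distrib, one_mul]
        rw [add_mul, one_mul]
        refine add_le_add (le_of_eq (Finset.sum_congr rfl fun i hi => ?_)) ?_
        · rw [Finset.sum_ite_eq, if_pos hi]
        · rw [Finset.sum_comm, Finset.mul_sum]
          refine Finset.sum_le_sum fun j _ => ?_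
          rw [← Finset.sum_filter, Finset.sum_const, nsmul_eq_mul]
          refine mul_le_mul_of_nonneg_right ?_ measureReal_nonneg
          have : ((Finset.range K).filter (· ∈ Finset.range I)).card ≤ (Finset.range I).card :=
            Finset.card_le_card fun x hx => (Finset.mem_filter.1 hx).2
          rw [Finset.card_range] at this
          exact_mod_cast this
  filter_upwards [hae] with ω ⟨i, hi⟩
  exact ⟨t i, htT i, hi⟩

end Divergence

/-! ### The cases of the criterion -/

section Criterion

variable {F : StieltjesFunction ℝ} {b : ℝ → ℝ}

theorem tailAt_nonneg (hF1 : Tendsto F atTop (𝓝 1)) (t : ℝ) : 0 ≤ tailAt F b t :=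
  sub_nonneg.2 (le_one_of_tendsto_atTop hF1 _)

theorem tailAt_le_one (hF0 : Tendsto F atBot (𝓝 0)) (t : ℝ) : tailAt F b t ≤ 1 :=
  sub_le_self 1 (nonneg_of_tendsto_atBot hF0 _)

theorem antitoneOn_tailAt (hb : MonotoneOn b (Ici 0)) : AntitoneOn (tailAt F b) (Ici 0) :=
  fun _ hs _ ht hst => sub_le_sub_left (F.mono (hb hs ht hst)) 1

theorem apply_eq_one_sub_tailAt (F b : ℝ → ℝ) (t : ℝ) : F (b t) = 1 - tailAt F b t :=
  (sub_sub_cancel 1 (F (b t))).symm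

theorem exists_tendsto_tailAt (hF1 : Tendsto F atTop (𝓝 1)) (hb : MonotoneOn b (Ici 0)) :
    ∃ c, 0 ≤ c ∧ Tendsto (tailAt F b) atTop (𝓝 c) := by
  -- The truncation `max t 0` is needed because `b` is monotone only on [0, ∞).
  have hanti : Antitone fun t => tailAt F b (max t 0) := fun s t hst =>
    antitoneOn_tailAt hb (le_max_right s 0) (le_max_right t 0) (max_le_max_right 0 hst)
  have hbdd : BddBelow (range fun t => tailAt F b (max t 0)) :=
    ⟨0, by rintro _ ⟨t, rfl⟩; exact tailAt_nonneg hF1 _⟩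
  refine ⟨_, le_ciInf fun t => tailAt_nonneg hF1 _,
    (tendsto_atTop_ciInf hanti hbdd).congr' ?_⟩
  filter_upwards [eventually_ge_atTop 0] with t ht
  rw [max_eq_left ht]

variable {N : Ω → Measure (ℝ × ℝ)}

theorem ae_notMem_eventuallyAbove_of_exists_void {T₀ : ℕ}
    (h : ∀ T : ℕ, T₀ ≤ T →
      ∀ᵐ ω ∂P, ∃ t : ℝ, T ≤ t ∧ N ω (Ioc (0 : ℝ) t ×ˢ Ioi (b t)) = 0) :
    ∀ᵐ ω ∂P, ω ∉ eventuallyAbove N b := by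
  have hall : ∀ᵐ ω ∂P, ∀ T : ℕ, T₀ ≤ T →
      ∃ t : ℝ, T ≤ t ∧ N ω (Ioc (0 : ℝ) t ×ˢ Ioi (b t)) = 0 := by
    rw [ae_all_iff]
    intro T
    by_cases hT : T₀ ≤ T
    · filter_upwards [h T hT] with ω hω _ using hω
    · exact Eventually.of_forall fun ω hT' => absurd hT' hT
  filter_upwards [hall] with ω hω hmem
  rw [mem_eventuallyAbove_iff] at hmem
  obtain ⟨S, hS⟩ := eventually_atTop.1 hmem
  obtain ⟨T, hT⟩ := exists_nat_ge S
  obtain ⟨t, ht, h0⟩ := hω (max T T₀) (le_max_right _ _)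
  exact hS t (hT.trans ((Nat.cast_le.2 (le_max_left _ _)).trans ht)) h0

variable [IsProbabilityMeasure P]

theorem ae_notMem_eventuallyAbove_of_frequently_lt (hF0 : Tendsto F atBot (𝓝 0))
    (hF1 : Tendsto F atTop (𝓝 1)) (hN : IsPoissonPointProcess N (intensity F) P)
    (hb : MonotoneOn b (Ici 0)) (hg : Tendsto (tailAt F b) atTop (𝓝 0)) {C : ℝ}
    (hC : ∃ᶠ t in atTop, t * tailAt F b t < C) :
    ∀ᵐ ω ∂P, ω ∉ eventuallyAbove N b := by
  have hhalf : ∀ᶠ t in atTop, tailAt F b t ≤ 1 / 2 := hg.eventually_le_const (by norm_num)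
  obtain ⟨S, hS⟩ := eventually_atTop.1 hhalf
  obtain ⟨T₀, hT₀⟩ := exists_nat_ge S
  have hpos : ∀ t : ℝ, T₀ ≤ t → 0 < F (b t) := fun t ht => by
    rw [apply_eq_one_sub_tailAt F b]
    linarith [hS t (hT₀.trans ht)]
  have hk0 : Tendsto (fun t => -Real.log (F (b t))) atTop (𝓝 0) := by
    have h1 : Tendsto (fun t => -Real.log (1 - tailAt F b t)) atTop (𝓝 (-Real.log (1 - 0))) :=
      ((tendsto_const_nhds.sub hg).log (by norm_num)).neg
    rw [sub_zero, Real.log_one, neg_zero] at h1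
    simpa only [← apply_eq_one_sub_tailAt] using h1
  have hC' : ∃ᶠ t in atTop, t * -Real.log (F (b t)) < 2 * C := by
    refine (hC.and_eventually (hhalf.and (eventually_ge_atTop 0))).mono ?_
    rintro t ⟨h1, h2, h3⟩
    have h4 := neg_log_one_sub_le h2
    rw [← apply_eq_one_sub_tailAt F b] at h4
    have h5 : -Real.log (F (b t)) ≤ 2 * tailAt F b t := by
      nlinarith [tailAt_nonneg (b := b) hF1 t]
    nlinarith [mul_le_mul_of_nonneg_left h5 h3]
  refine ae_notMem_eventuallyAbove_of_exists_void (T₀ := T₀) fun T hT => ?_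
  exact exists_void_of_frequently_lt hF0 hF1 hN hb (fun t => rfl) hk0 T.cast_nonneg
    (fun t ht => hpos t ((Nat.cast_le.2 hT).trans ht)) hC'

theorem ae_notMem_eventuallyAbove_of_J_eq_top (hF0 : Tendsto F atBot (𝓝 0))
    (hF1 : Tendsto F atTop (𝓝 1)) (hN : IsPoissonPointProcess N (intensity F) P)
    (hb : MonotoneOn b (Ici 0)) (hg : Tendsto (tailAt F b) atTop (𝓝 0))
    (htg : Tendsto (fun t : ℝ => t * tailAt F b t) atTop atTop) (hJ : J F b = ∞) :
    ∀ᵐ ω ∂P, ω ∉ eventuallyAbove N b := by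
  have hhalf : ∀ᶠ t in atTop, tailAt F b t ≤ 1 / 2 := hg.eventually_le_const (by norm_num)
  obtain ⟨S, hS⟩ := eventually_atTop.1 hhalf
  obtain ⟨T₀, hT₀⟩ := exists_nat_ge S
  have hpos : ∀ n : ℕ, T₀ ≤ n → Real.exp (-1) ≤ F (b n) := fun n hn => by
    rw [apply_eq_one_sub_tailAt F b]
    have h1 := hS n (hT₀.trans (Nat.cast_le.2 hn))
    have h2 := Real.add_one_le_exp 1
    have h3 : Real.exp (-1) ≤ 1 / 2 := by
      rw [Real.exp_neg, inv_le_comm₀ (Real.exp_pos _) (by norm_num)]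
      linarith
    linarith
  have hns : ¬ Summable fun n : ℕ =>
      (1 - F (b n)) * Real.exp (-(n * -Real.log (F (b n)))) := by
    intro hs
    refine not_summable_of_lintegral_eq_top (antitoneOn_tailAt hb) (tailAt_nonneg hF1)
      (tailAt_le_one hF0) htg hJ ?_
    refine Summable.of_norm_bounded_eventually_nat ((hs.mul_left (Real.exp 2)).add
      ((Real.summable_one_div_nat_pow.2 (by norm_num : 1 < 2)).mul_left 24)) ?_
    filter_upwards [eventually_ge_atTop T₀] with n hn
    have h0 := tailAt_nonneg (b := b) hF1 n
    rw [Real.norm_of_nonneg (mul_nonneg h0 (Real.exp_pos _).le)]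
    have h1 := mul_exp_neg_le_add h0 (hS n (hT₀.trans (Nat.cast_le.2 hn))) n
    rwa [← apply_eq_one_sub_tailAt F b] at h1
  have hmono : Monotone fun n : ℕ => b n := fun m n hmn =>
    hb (mem_Ici.2 m.cast_nonneg) (mem_Ici.2 n.cast_nonneg) (Nat.cast_le.2 hmn)
  refine ae_notMem_eventuallyAbove_of_exists_void (T₀ := T₀) fun T hT => ?_
  filter_upwards [exists_void_of_not_summable hF0 hF1 hN hmono
    (fun n hn => hpos n (hT.trans hn)) hns] with ω ⟨n, hn, h0⟩
  exact ⟨n, Nat.cast_le.2 hn, h0⟩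

theorem ae_mem_eventuallyAbove_of_J_lt_top (hF0 : Tendsto F atBot (𝓝 0))
    (hF1 : Tendsto F atTop (𝓝 1)) (hN : IsPoissonPointProcess N (intensity F) P)
    (hb : MonotoneOn b (Ici 0)) (hg : Tendsto (tailAt F b) atTop (𝓝 0))
    (htg : Tendsto (fun t : ℝ => t * tailAt F b t) atTop atTop) (hJ : J F b < ∞) :
    ∀ᵐ ω ∂P, ω ∈ eventuallyAbove N b := by
  have hsucc : Tendsto (fun n : ℕ => (n : ℝ) + 1) atTop atTop :=
    tendsto_atTop_add_const_right _ _ tendsto_natCast_atTop_atTop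
  -- Time n is paired with the level b(n+1): for n ≤ t < n+1, a point in (0, n] above b(n+1) is a
  -- point in (0, t] above b(t).
  have hmono : Monotone fun n : ℕ => b (n + 1) := fun m n hmn =>
    hb (mem_Ici.2 (by positivity)) (mem_Ici.2 (by positivity))
      (add_le_add_left (Nat.cast_le.2 hmn) 1)
  have hpos : ∀ᶠ n : ℕ in atTop, 0 < F (b (n + 1)) := by
    filter_upwards [hsucc.eventually (hg.eventually_lt_const one_pos)] with n hn
    rw [apply_eq_one_sub_tailAt F b]
    linarith
  have hlim : Tendsto (fun n : ℕ => (n : ℝ) * (1 - F (b (n + 1)))) atTop atTop := by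
    refine tendsto_atTop_mono (fun n => ?_)
      (tendsto_atTop_add_const_right atTop (-1 : ℝ) (htg.comp hsucc))
    have := tailAt_le_one (b := b) hF0 ((n : ℝ) + 1)
    change ((n : ℝ) + 1) * tailAt F b (n + 1) + -1 ≤ n * tailAt F b (n + 1)
    linarith
  have hsum := tsum_ne_top_of_lintegral_lt_top (antitoneOn_tailAt hb) (tailAt_nonneg hF1)
    (tailAt_le_one hF0) htg hJ
  filter_upwards [ae_eventually_ne_zero_of_exits hF0 hF1 hN hmono hpos hlim hsum] with ω hω
  rw [mem_eventuallyAbove_iff]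
  filter_upwards [(tendsto_nat_floor_atTop (α := ℝ)).eventually hω, eventually_ge_atTop 0]
    with t ht ht0 h0
  refine ht (measure_mono_null (prod_mono (Ioc_subset_Ioc_right (Nat.floor_le ht0))
    (Ioi_subset_Ioi ?_)) h0)
  exact hb ht0 (mem_Ici.2 (by positivity)) (Nat.lt_floor_add_one t).le

theorem ae_mem_or_ae_notMem_eventuallyAbove (hF0 : Tendsto F atBot (𝓝 0))
    (hF1 : Tendsto F atTop (𝓝 1)) (hN : IsPoissonPointProcess N (intensity F) P)
    (hb : MonotoneOn b (Ici 0)) :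
    (∀ᵐ ω ∂P, ω ∈ eventuallyAbove N b) ∨ ∀ᵐ ω ∂P, ω ∉ eventuallyAbove N b := by
  obtain ⟨c, hc0, hc⟩ := exists_tendsto_tailAt hF1 hb
  rcases hc0.lt_or_eq with hpos | rfl
  · exact Or.inl (ae_mem_eventuallyAbove_of_tendsto_pos hF0 hF1 hN hb hpos hc)
  by_cases htg : Tendsto (fun t : ℝ => t * tailAt F b t) atTop atTop
  · rcases eq_or_ne (J F b) ∞ with hJ | hJ
    · exact Or.inr (ae_notMem_eventuallyAbove_of_J_eq_top hF0 hF1 hN hb hc htg hJ)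
    · exact Or.inl (ae_mem_eventuallyAbove_of_J_lt_top hF0 hF1 hN hb hc htg hJ.lt_top)
  · rw [tendsto_atTop] at htg
    push Not at htg
    obtain ⟨C, hC⟩ := htg
    exact Or.inr (ae_notMem_eventuallyAbove_of_frequently_lt hF0 hF1 hN hb hc hC)

end Criterion

end ExtremalProcess

theorem theorem2
    (F : StieltjesFunction ℝ) (hF0 : Tendsto F atBot (𝓝 0)) (hF1 : Tendsto F atTop (𝓝 1))
    (hFx : ∀ x₀ : ℝ, IsGLB {x : ℝ | 0 < F x} x₀ → F x₀ = 0)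
    {Ω : Type*} [MeasurableSpace Ω] (P : Measure Ω) [IsProbabilityMeasure P]
    (N : Ω → Measure (ℝ × ℝ))
    (hN : ExtremalProcess.IsPoissonPointProcess N (ExtremalProcess.intensity F) P)
    (b : ℝ → ℝ) (hb : MonotoneOn b (Ici 0))
    (hbr : ∀ t : ℝ, 0 ≤ t → ContinuousWithinAt b (Ici t) t) :
    NullMeasurableSet (ExtremalProcess.eventuallyAbove N b) P ∧
    (P (ExtremalProcess.eventuallyAbove N b) = 0 ∨
      P (ExtremalProcess.eventuallyAbove N b) = 1) ∧
    (∀ c : ℝ, 0 < c → Tendsto (ExtremalProcess.tailAt F b) atTop (𝓝 c) →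
      P (ExtremalProcess.eventuallyAbove N b) = 1) ∧
    (Tendsto (ExtremalProcess.tailAt F b) atTop (𝓝 0) →
      liminf (fun t : ℝ => ((t * ExtremalProcess.tailAt F b t : ℝ) : EReal)) atTop < ⊤ →
      P (ExtremalProcess.eventuallyAbove N b) = 0) ∧
    (Tendsto (ExtremalProcess.tailAt F b) atTop (𝓝 0) →
      Tendsto (fun t : ℝ => t * ExtremalProcess.tailAt F b t) atTop atTop →
      (ExtremalProcess.J F b = ∞ → P (ExtremalProcess.eventuallyAbove N b) = 0) ∧
      (ExtremalProcess.J F b < ∞ → P (ExtremalProcess.eventuallyAbove N b) = 1)) := by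
  open ExtremalProcess in
  have one : (∀ᵐ ω ∂P, ω ∈ eventuallyAbove N b) → P (eventuallyAbove N b) = 1 := fun h =>
    (measure_congr (eventuallyEq_univ.2 h)).trans measure_univ
  have zero : (∀ᵐ ω ∂P, ω ∉ eventuallyAbove N b) → P (eventuallyAbove N b) = 0 :=
    measure_eq_zero_iff_ae_notMem.2
  have hdich := ae_mem_or_ae_notMem_eventuallyAbove hF0 hF1 hN hb
  refine ⟨?_, hdich.symm.imp zero one, fun c hc h =>
    one (ae_mem_eventuallyAbove_of_tendsto_pos hF0 hF1 hN hb hc h), fun hg hlim => zero ?_,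
    fun hg htg => ⟨fun hJ => zero (ae_notMem_eventuallyAbove_of_J_eq_top hF0 hF1 hN hb hg htg hJ),
      fun hJ => one (ae_mem_eventuallyAbove_of_J_lt_top hF0 hF1 hN hb hg htg hJ)⟩⟩
  -- The event is almost surely everything or almost surely empty, hence null measurable.
  · rcases hdich with h | h
    · exact nullMeasurableSet_univ.congr (eventuallyEq_univ.2 h).symm
    · exact NullMeasurableSet.of_null (zero h)
  · obtain ⟨C, hC, -⟩ := EReal.lt_iff_exists_real_btwn.1 hlim
    refine ae_notMem_eventuallyAbove_of_frequently_lt hF0 hF1 hN hb hg (C := C) ?_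
    exact (frequently_lt_of_liminf_lt (by isBoundedDefault) hC).mono fun t ht =>
      EReal.coe_lt_coe_iff.1 ht
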